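/- \textbf{Theorem (Groupoid uniqueness).} Conventions. A groupoid $\mathcal G$ is regarded as its set of arrows, with domain map $d$ and range map $r$, each object being identified with its identity arrow; $\mathcal G^0\subseteq\mathcal G$ is the set of identities, and a product $\alpha\beta$ is defined exactly when $d(\alpha)=r(\beta)$. A topological groupoid (domain, range, multiplication and inversion continuous; $\mathcal G^0$ with the subspace topology) is \emph{\'etale} if $d\colon\mathcal G\to\mathcal G^0$ is a local homeomorphism; $\mathcal G^0$ is always assumed locally compact and Hausdorff, but $\mathcal G$ need not be Hausdorff. It is \emph{ample} if, in addition, $\mathcal G^0$ has a basis of compact open sets. It is \emph{topologically free} if the set $\{g\in\mathcal G: d(g)=r(g)\}\setminus\mathcal G^0$ has empty interior in $\mathcal G$. A \emph{local bisection} is an open set $U\subseteq\mathcal G$ on which $d$ and $r$ restrict to homeomorphisms onto their images. For a field $K$, the algebra $K\mathcal G$ is the $K$-linear span, inside $K^{\mathcal G}$, of the characteristic functions $\chi_U$ of compact local bisections $U$, with the convolution product $(f*g)(\gamma)=\sum_{\alpha\beta=\gamma}f(\alpha)g(\beta)$. A function $f\in K\mathcal G$ is \emph{singular} if $\{\gamma\in\mathcal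 G: f(\gamma)\neq 0\}$ has empty interior; the singular functions form a two-sided ideal $\mathrm{Sing}_K(\mathcal G)$ of $K\mathcal G$, and $K\mathcal G/\mathrm{Sing}_K(\mathcal G)$ is the \emph{essential algebra} of $\mathcal G$ over $K$. Ideals are two-sided. Let $\mathcal G$ be a topologically free ample groupoid and let $K$ be a field. Then every non-zero ideal of the essential algebra $K\mathcal G/\mathrm{Sing}_K(\mathcal G)$ contains a coset $\chi_U+\mathrm{Sing}_K(\mathcal G)$ with $U$ a non-empty compact open subset of $\mathcal G^0$. In particular, if $\mathcal G$ is Hausdorff, then every non-zero ideal of $K\mathcal G$ contains an element $\chi_U$ with $U$ a non-empty compact open subset of $\mathcal G^0$. -/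

import Mathlib

open Set Topology

set_option linter.unusedSectionVars false

/-- A groupoid, given by its set of arrows `G`; an object is identified with the identity arrow at
that object. `dom g` and `rng g` are the (identity arrows at the) domain and range of `g`, and the
product `comp g h` is defined precisely when `dom g = rng h`. -/
class ArrowGroupoid (G : Type*) where
  dom : G → G
  rng : G → G
  inv : G → G
  comp : (g h : G) → dom g = rng h → G
  dom_dom : ∀ g, dom (dom g) = dom g
  rng_dom : ∀ g, rng (dom g) = dom g
  dom_rng : ∀ g, dom (rng g) = rng g
  rng_rng : ∀ g, rng (rng g) = rng g
  dom_comp : ∀ g h (hc : dom g = rng h), dom (comp g h hc) = dom h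
  rng_comp : ∀ g h (hc : dom g = rng h), rng (comp g h hc) = rng g
  comp_assoc : ∀ g h k (h₁ : dom g = rng h) (h₂ : dom h = rng k),
    comp (comp g h h₁) k ((dom_comp g h h₁).trans h₂)
      = comp g (comp h k h₂) (h₁.trans (rng_comp h k h₂).symm)
  rng_id_comp : ∀ g, comp (rng g) g (dom_rng g) = g
  comp_dom_id : ∀ g, comp g (dom g) (rng_dom g).symm = g
  dom_inv : ∀ g, dom (inv g) = rng g
  rng_inv : ∀ g, rng (inv g) = dom g
  inv_comp : ∀ g, comp (inv g) g (dom_inv g) = dom g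
  comp_inv : ∀ g, comp g (inv g) (rng_inv g).symm = rng g

namespace ArrowGroupoid

variable (G : Type*) [ArrowGroupoid G]

/-- The set of identity arrows. -/
def units : Set G := {g | dom g = g}

/-- The unit space `G⁰`; it carries the subspace topology. -/
abbrev UnitSpace : Type _ := units G

/-- The set of composable pairs. -/
abbrev ComposablePair : Type _ := {p : G × G // dom p.1 = rng p.2}

/-- The isotropy subgroupoid. -/
def isotropy : Set G := {g | dom g = rng g}

variable {G}

/-- The domain map, with values in the unit space. -/
def domU (g : G) : UnitSpace G := ⟨dom g, dom_dom g⟩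

/-- The range map, with values in the unit space. -/
def rngU (g : G) : UnitSpace G := ⟨rng g, dom_rng g⟩

/-- The product of two sets of arrows. -/
def setMul (A B : Set G) : Set G :=
  {g | ∃ a ∈ A, ∃ b ∈ B, ∃ hc : dom a = rng b, comp a b hc = g}

end ArrowGroupoid

open ArrowGroupoid

/-- Topological groupoids: all structure maps are continuous. -/
class IsTopologicalGroupoid (G : Type*) [TopologicalSpace G] [ArrowGroupoid G] : Prop where
  continuous_dom : Continuous (dom : G → G)
  continuous_rng : Continuous (rng : G → G)
  continuous_inv : Continuous (inv : G → G)
  continuous_comp : Continuous (fun p : ComposablePair G => comp p.1.1 p.1.2 p.2)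

/-- Étale groupoids, with locally compact Hausdorff unit space (`G` itself need not be
Hausdorff). -/
class IsEtaleGroupoid (G : Type*) [TopologicalSpace G] [ArrowGroupoid G] : Prop
    extends IsTopologicalGroupoid G where
  isLocalHomeomorph_domU : IsLocalHomeomorph (domU : G → UnitSpace G)
  locallyCompactSpace_units : LocallyCompactSpace (UnitSpace G)
  t2Space_units : T2Space (UnitSpace G)

/-- Ample groupoids: étale groupoids whose unit space has a basis of compact open sets. -/
class IsAmpleGroupoid (G : Type*) [TopologicalSpace G] [ArrowGroupoid G] : Prop
    extends IsEtaleGroupoid G where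
  isTopologicalBasis_units :
    TopologicalSpace.IsTopologicalBasis {U : Set (UnitSpace G) | IsCompact U ∧ IsOpen U}

/-- Topological freeness: the set of non-identity isotropy arrows has empty interior. -/
def IsTopologicallyFree (G : Type*) [TopologicalSpace G] [ArrowGroupoid G] : Prop :=
  interior (isotropy G \ units G) = ∅

/-- A local bisection: an open set of arrows on which the domain and the range map are
homeomorphisms onto their images. -/
structure IsLocalBisection {G : Type*} [TopologicalSpace G] [ArrowGroupoid G] (U : Set G) :
    Prop where
  isOpen : IsOpen U
  isEmbedding_domU : IsEmbedding (fun g : U => domU (g : G))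
  isEmbedding_rngU : IsEmbedding (fun g : U => rngU (g : G))

/-- The convolution product `(f * g)(γ) = ∑_{αβ = γ} f(α) g(β)`. -/
noncomputable def convolution {K G : Type*} [CommRing K] [ArrowGroupoid G] (f g : G → K)
    (γ : G) : K :=
  ∑ᶠ p : {p : ComposablePair G // comp p.1.1 p.1.2 p.2 = γ}, f p.1.1.1 * g p.1.1.2

/-- The characteristic function of a set of arrows. -/
noncomputable def charFn (K : Type*) {G : Type*} [CommRing K] (U : Set G) : G → K :=
  U.indicator (fun _ => 1)

/-- The span, in the space of all functions from `G` to `K`, of the characteristic functions of the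
compact local bisections. -/
def steinbergSubmodule (K G : Type*) [CommRing K] [TopologicalSpace G] [ArrowGroupoid G] :
    Submodule K (G → K) :=
  Submodule.span K {f | ∃ U : Set G, IsCompact U ∧ IsLocalBisection U ∧ f = charFn K U}

/-- The Steinberg algebra of `G` over `K`; its product, defined below, is the convolution. -/
def SteinbergAlgebra (K G : Type*) [CommRing K] [TopologicalSpace G] [ArrowGroupoid G] : Type _ :=
  steinbergSubmodule K G

namespace ArrowGroupoid

section Algebraic

variable {G : Type*} [ArrowGroupoid G]

theorem comp_congr {a a' b b' : G} (ha : a = a') (hb : b = b') (hc : dom a = rng b) :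
    comp a b hc = comp a' b' (ha ▸ hb ▸ hc) := by
  subst ha; subst hb; rfl

theorem inv_comp_cancel (a b : G) (hc : dom a = rng b) :
    comp (inv a) (comp a b hc) ((dom_inv a).trans (rng_comp a b hc).symm) = b := by
  rw [← comp_assoc (inv a) a b (dom_inv a) hc]
  rw [comp_congr (inv_comp a) rfl, comp_congr hc rfl, rng_id_comp]

theorem comp_inv_cancel (a b : G) (hc : rng a = rng b) :
    comp a (comp (inv a) b ((dom_inv a).trans hc))
      ((rng_inv a).symm.trans (rng_comp _ _ _).symm) = b := by
  rw [← comp_assoc a (inv a) b (rng_inv a).symm ((dom_inv a).trans hc)]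
  rw [comp_congr (comp_inv a) rfl, comp_congr hc rfl, rng_id_comp]

theorem comp_inv_cancel_right (a b : G) (hc : dom a = rng b) :
    comp (comp a b hc) (inv b) ((dom_comp a b hc).trans (rng_inv b).symm) = a := by
  rw [comp_assoc a b (inv b) hc (rng_inv b).symm]
  rw [comp_congr rfl (comp_inv b), comp_congr rfl hc.symm, comp_dom_id]

theorem comp_left_cancel {a b b' : G} {h : dom a = rng b} {h' : dom a = rng b'}
    (e : comp a b h = comp a b' h') : b = b' := by
  rw [← inv_comp_cancel a b h, ← inv_comp_cancel a b' h']
  exact comp_congr rfl e _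

theorem comp_right_cancel {a a' b : G} {h : dom a = rng b} {h' : dom a' = rng b}
    (e : comp a b h = comp a' b h') : a = a' := by
  rw [← comp_inv_cancel_right a b h, ← comp_inv_cancel_right a' b h']
  exact comp_congr e rfl _

theorem inv_inv (a : G) : inv (inv a) = a := by
  have h1 : dom (inv (inv a)) = rng (inv a) := dom_inv _
  have h2 : dom a = rng (inv a) := (rng_inv a).symm
  refine comp_right_cancel (b := inv a) (h := h1) (h' := h2) ?_
  rw [inv_comp, comp_inv, dom_inv]

theorem rng_eq_of_mem_units {x : G} (hx : x ∈ units G) : rng x = x := by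
  have h : dom x = x := hx
  rw [← h, rng_dom]

theorem setMul_assoc (A B C : Set G) : setMul (setMul A B) C = setMul A (setMul B C) := by
  ext g
  constructor
  · rintro ⟨_, ⟨a, ha, b, hb, h1, rfl⟩, c, hc, h2, rfl⟩
    rw [dom_comp] at h2
    exact ⟨a, ha, comp b c h2, ⟨b, hb, c, hc, h2, rfl⟩, h1.trans (rng_comp _ _ _).symm,
      (comp_assoc a b c h1 h2).symm⟩
  · rintro ⟨a, ha, _, ⟨b, hb, c, hc, h2, rfl⟩, h1, rfl⟩
    rw [rng_comp] at h1
    exact ⟨comp a b h1, ⟨a, ha, b, hb, h1, rfl⟩, c, hc, (dom_comp _ _ _).trans h2,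
      comp_assoc a b c h1 h2⟩

end Algebraic

section Topological

variable {G : Type*} [TopologicalSpace G] [ArrowGroupoid G]

theorem continuous_domU [IsTopologicalGroupoid G] : Continuous (domU : G → UnitSpace G) :=
  IsTopologicalGroupoid.continuous_dom.subtype_mk _

theorem continuous_rngU [IsTopologicalGroupoid G] : Continuous (rngU : G → UnitSpace G) :=
  IsTopologicalGroupoid.continuous_rng.subtype_mk _

variable [IsEtaleGroupoid G]

theorem isLocalHomeomorph_rngU : IsLocalHomeomorph (rngU : G → UnitSpace G) := by
  have hi : IsLocalHomeomorph (inv : G → G) :=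
    (Homeomorph.mk ⟨inv, inv, inv_inv, inv_inv⟩ IsTopologicalGroupoid.continuous_inv
      IsTopologicalGroupoid.continuous_inv).isLocalHomeomorph
  have he : (rngU : G → UnitSpace G) = domU ∘ inv :=
    funext fun g => Subtype.ext (dom_inv g).symm
  rw [he]
  exact IsEtaleGroupoid.isLocalHomeomorph_domU.comp hi

theorem isOpen_units : IsOpen (units G) := by
  rw [isOpen_iff_mem_nhds]
  intro x hx
  obtain ⟨e, hxe, he⟩ := (IsEtaleGroupoid.isLocalHomeomorph_domU (G := G)) x
  have hx' : dom x = x := hx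
  have h2 : dom ⁻¹' e.source ∈ 𝓝 x :=
    (IsTopologicalGroupoid.continuous_dom.isOpen_preimage _ e.open_source).mem_nhds
      (by simpa [hx'] using hxe)
  filter_upwards [e.open_source.mem_nhds hxe, h2] with g hg hg'
  refine e.injOn hg' hg ?_
  rw [← he]
  exact Subtype.ext (dom_dom g)

theorem isLocalBisection_iff {U : Set G} :
    IsLocalBisection U ↔ IsOpen U ∧ InjOn (dom : G → G) U ∧ InjOn (rng : G → G) U := by
  constructor
  · intro h
    refine ⟨h.isOpen, fun a ha b hb e => ?_, fun a ha b hb e => ?_⟩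
    · exact congrArg Subtype.val
        (@IsEmbedding.injective _ _ _ _ _ h.isEmbedding_domU ⟨a, ha⟩ ⟨b, hb⟩ (Subtype.ext e))
    · exact congrArg Subtype.val
        (@IsEmbedding.injective _ _ _ _ _ h.isEmbedding_rngU ⟨a, ha⟩ ⟨b, hb⟩ (Subtype.ext e))
  · rintro ⟨ho, hd, hr⟩
    refine ⟨ho, ?_, ?_⟩
    · refine (IsOpenEmbedding.of_continuous_injective_isOpenMap
        (continuous_domU.comp continuous_subtype_val) ?_
        (IsEtaleGroupoid.isLocalHomeomorph_domU.isOpenMap.comp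
          ho.isOpenMap_subtype_val)).isEmbedding
      exact fun a b e => Subtype.ext (hd a.2 b.2 (congrArg Subtype.val e))
    · refine (IsOpenEmbedding.of_continuous_injective_isOpenMap
        (continuous_rngU.comp continuous_subtype_val) ?_
        (isLocalHomeomorph_rngU.isOpenMap.comp ho.isOpenMap_subtype_val)).isEmbedding
      exact fun a b e => Subtype.ext (hr a.2 b.2 (congrArg Subtype.val e))

theorem isOpen_setMul {A B : Set G} (hA : IsOpen A) (hB : IsOpen B) : IsOpen (setMul A B) := by
  rw [isOpen_iff_mem_nhds]
  rintro _ ⟨u, hu, v, hv, hc, rfl⟩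
  obtain ⟨e, hue, he⟩ := (isLocalHomeomorph_rngU (G := G)) u
  let O : Set G := rngU ⁻¹' e.target
  have hO : IsOpen O := continuous_rngU.isOpen_preimage _ e.open_target
  let α : O → G := fun γ => e.symm (rngU γ.1)
  have hα : Continuous α :=
    e.continuousOn_symm.comp_continuous (continuous_rngU.comp continuous_subtype_val)
      (fun γ => γ.2)
  have hαr : ∀ γ : O, rng (α γ) = rng γ.1 := fun γ => by
    have h : e (e.symm (rngU γ.1)) = rngU γ.1 := e.right_inv γ.2
    rw [← he] at h
    exact congrArg Subtype.val h
  let q : O → ComposablePair G := fun γ => ⟨(inv (α γ), γ.1), (dom_inv _).trans (hαr γ)⟩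
  have hq : Continuous q :=
    ((IsTopologicalGroupoid.continuous_inv.comp hα).prodMk continuous_subtype_val).subtype_mk _
  let β : O → G := fun γ => comp (q γ).1.1 (q γ).1.2 (q γ).2
  have hβ : Continuous β := IsTopologicalGroupoid.continuous_comp.comp hq
  have hr : rngU (comp u v hc) = rngU u := Subtype.ext (rng_comp u v hc)
  have hg : comp u v hc ∈ O := by
    change rngU _ ∈ e.target
    rw [hr, he]
    exact e.map_source hue
  have hαu : α ⟨_, hg⟩ = u := by
    change e.symm (rngU (comp u v hc)) = u
    rw [hr, he]
    exact e.left_inv hue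
  have hβv : β ⟨_, hg⟩ = v := by
    change comp (inv (α ⟨_, hg⟩)) (comp u v hc) _ = v
    rw [comp_congr (congrArg inv hαu) rfl]
    exact inv_comp_cancel u v hc
  have hS : IsOpen (α ⁻¹' A ∩ β ⁻¹' B) := (hA.preimage hα).inter (hB.preimage hβ)
  refine Filter.mem_of_superset ((hO.isOpenMap_subtype_val _ hS).mem_nhds
    ⟨⟨_, hg⟩, ⟨by simpa [hαu] using hu, by simpa [hβv] using hv⟩, rfl⟩) ?_
  rintro _ ⟨γ, ⟨h1, h2⟩, rfl⟩
  exact ⟨α γ, h1, β γ, h2, _, comp_inv_cancel (α γ) γ.1 (hαr γ)⟩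

theorem isCompact_setMul {A B : Set G} (hA : IsCompact A) (hB : IsCompact B) :
    IsCompact (setMul A B) := by
  have := IsEtaleGroupoid.t2Space_units (G := G)
  have hcl : IsClosed {p : G × G | dom p.1 = rng p.2} := by
    have h : {p : G × G | dom p.1 = rng p.2} = {p : G × G | domU p.1 = rngU p.2} := by
      ext p
      exact (Subtype.ext_iff (a1 := domU p.1) (a2 := rngU p.2)).symm
    rw [h]
    exact isClosed_eq (continuous_domU.comp continuous_fst) (continuous_rngU.comp continuous_snd)
  have hK : IsCompact (Subtype.val ⁻¹' (A ×ˢ B) : Set (ComposablePair G)) :=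
    hcl.isClosedEmbedding_subtypeVal.isCompact_preimage (hA.prod hB)
  convert hK.image IsTopologicalGroupoid.continuous_comp using 1
  ext g
  constructor
  · rintro ⟨a, ha, b, hb, hc, rfl⟩
    exact ⟨⟨(a, b), hc⟩, ⟨ha, hb⟩, rfl⟩
  · rintro ⟨⟨⟨a, b⟩, hc⟩, ⟨ha, hb⟩, rfl⟩
    exact ⟨a, ha, b, hb, hc, rfl⟩

theorem isLocalBisection_setMul {A B : Set G} (hA : IsLocalBisection A)
    (hB : IsLocalBisection B) : IsLocalBisection (setMul A B) := by
  rw [isLocalBisection_iff] at *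
  obtain ⟨oA, dA, rA⟩ := hA
  obtain ⟨oB, dB, rB⟩ := hB
  refine ⟨isOpen_setMul oA oB, ?_, ?_⟩
  · rintro _ ⟨a, ha, b, hb, hc, rfl⟩ _ ⟨a', ha', b', hb', hc', rfl⟩ h
    rw [dom_comp, dom_comp] at h
    obtain rfl := dB hb hb' h
    obtain rfl := dA ha ha' (hc.trans hc'.symm)
    rfl
  · rintro _ ⟨a, ha, b, hb, hc, rfl⟩ _ ⟨a', ha', b', hb', hc', rfl⟩ h
    rw [rng_comp, rng_comp] at h
    obtain rfl := rA ha ha' h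
    obtain rfl := rB hb hb' (hc.symm.trans hc')
    rfl

theorem isLocalBisection_image_units {U : Set (UnitSpace G)} (hU : IsOpen U) :
    IsLocalBisection (Subtype.val '' U : Set G) := by
  rw [isLocalBisection_iff]
  refine ⟨isOpen_units.isOpenMap_subtype_val _ hU, ?_, ?_⟩
  · rintro _ ⟨x, -, rfl⟩ _ ⟨y, -, rfl⟩ h
    have hx : dom x.1 = x.1 := x.2
    have hy : dom y.1 = y.1 := y.2
    rw [← hx, ← hy, h]
  · rintro _ ⟨x, -, rfl⟩ _ ⟨y, -, rfl⟩ h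
    rw [← rng_eq_of_mem_units x.2, ← rng_eq_of_mem_units y.2, h]

end Topological

section Convolution

variable {K G : Type*} [CommRing K] [TopologicalSpace G] [ArrowGroupoid G] [IsEtaleGroupoid G]

theorem finite_fibre {f : G → K} (hf : f ∈ steinbergSubmodule K G) (x : G) :
    {α : G | rng α = x ∧ f α ≠ 0}.Finite := by
  induction hf using Submodule.span_induction with
  | mem f hf =>
    obtain ⟨U, -, hU, rfl⟩ := hf
    refine Set.Subsingleton.finite ?_
    rintro a ⟨ha, ha'⟩ b ⟨hb, hb'⟩
    exact (isLocalBisection_iff.1 hU).2.2 (mem_of_indicator_ne_zero ha')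
      (mem_of_indicator_ne_zero hb') (ha.trans hb.symm)
  | zero => simp
  | add f g _ _ hf hg =>
    refine (hf.union hg).subset ?_
    rintro a ⟨ha, h⟩
    by_contra hn
    simp only [mem_union, mem_ofPred_eq, ha, true_and, not_or, not_not] at hn
    exact h (by simp [hn.1, hn.2])
  | smul c f _ hf =>
    refine hf.subset ?_
    rintro a ⟨ha, h⟩
    exact ⟨ha, fun h0 => h (by simp [h0])⟩

theorem finite_support_convolution {f : G → K} (hf : f ∈ steinbergSubmodule K G) (g : G → K)
    (γ : G) : (Function.support
      (fun p : {p : ComposablePair G // comp p.1.1 p.1.2 p.2 = γ} =>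
        f p.1.1.1 * g p.1.1.2)).Finite := by
  refine Set.Finite.of_finite_image (f := fun p => p.1.1.1)
    ((finite_fibre hf (rng γ)).subset ?_) ?_
  · rintro _ ⟨⟨⟨⟨a, b⟩, hc⟩, rfl⟩, hp, rfl⟩
    exact ⟨(rng_comp a b hc).symm, fun h0 => hp (by simp [h0])⟩
  · rintro ⟨⟨⟨a, b⟩, hc⟩, h⟩ - ⟨⟨⟨a', b'⟩, hc'⟩, h'⟩ - e
    dsimp only at e
    subst e
    obtain rfl := comp_left_cancel (h.trans h'.symm)
    rfl

theorem convolution_add_left {f f' : G → K} (hf : f ∈ steinbergSubmodule K G)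
    (hf' : f' ∈ steinbergSubmodule K G) (g : G → K) :
    convolution (f + f') g = convolution f g + convolution f' g := by
  funext γ
  simp only [convolution, Pi.add_apply, add_mul]
  exact finsum_add_distrib (finite_support_convolution hf g γ)
    (finite_support_convolution hf' g γ)

theorem convolution_add_right {f : G → K} (hf : f ∈ steinbergSubmodule K G) (g g' : G → K) :
    convolution f (g + g') = convolution f g + convolution f g' := by
  funext γ
  simp only [convolution, Pi.add_apply, mul_add]
  exact finsum_add_distrib (finite_support_convolution hf g γ)
    (finite_support_convolution hf g' γ)

theorem convolution_smul_left (c : K) {f : G → K} (hf : f ∈ steinbergSubmodule K G) (g : G → K) :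
    convolution (c • f) g = c • convolution f g := by
  funext γ
  simp only [convolution, Pi.smul_apply, smul_eq_mul, mul_assoc]
  exact (mul_finsum' _ c (finite_support_convolution hf g γ)).symm

theorem convolution_smul_right (c : K) {f : G → K} (hf : f ∈ steinbergSubmodule K G)
    (g : G → K) : convolution f (c • g) = c • convolution f g := by
  funext γ
  simp only [convolution, Pi.smul_apply, smul_eq_mul, mul_left_comm _ c]
  exact (mul_finsum' _ c (finite_support_convolution hf g γ)).symm

theorem convolution_zero_left (g : G → K) : convolution (0 : G → K) g = 0 := by
  funext γ
  simp [convolution]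

theorem convolution_zero_right (f : G → K) : convolution f (0 : G → K) = 0 := by
  funext γ
  simp [convolution]

theorem charFn_mem {U : Set G} (hc : IsCompact U) (hU : IsLocalBisection U) :
    charFn K U ∈ steinbergSubmodule K G :=
  Submodule.subset_span ⟨U, hc, hU, rfl⟩

theorem convolution_charFn {U V : Set G} (hU : IsLocalBisection U) :
    convolution (charFn K U) (charFn K V) = charFn K (setMul U V) := by
  funext γ
  by_cases h : γ ∈ setMul U V
  · obtain ⟨u, hu, v, hv, hc, rfl⟩ := h
    have h1 : charFn K (setMul U V) (comp u v hc) = 1 :=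
      indicator_of_mem (show _ ∈ setMul U V from ⟨u, hu, v, hv, hc, rfl⟩) _
    rw [h1, convolution, finsum_eq_single _ ⟨⟨(u, v), hc⟩, rfl⟩]
    · simp [charFn, hu, hv]
    · rintro ⟨⟨⟨a, b⟩, hc'⟩, h'⟩ hne
      by_cases ha : a ∈ U
      · exfalso
        apply hne
        have hr : rng a = rng u := by
          rw [← rng_comp a b hc', h', rng_comp]
        obtain rfl := (isLocalBisection_iff.1 hU).2.2 ha hu hr
        obtain rfl := comp_left_cancel h'
        rfl
      · simp [charFn, ha]
  · have h1 : charFn K (setMul U V) γ = 0 := indicator_of_notMem h _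
    rw [h1]
    refine finsum_eq_zero_of_forall_eq_zero ?_
    rintro ⟨⟨⟨a, b⟩, hc'⟩, h'⟩
    by_cases ha : a ∈ U
    · by_cases hb : b ∈ V
      · exact (h ⟨a, ha, b, hb, hc', h'⟩).elim
      · simp [charFn, hb]
    · simp [charFn, ha]

theorem convolution_mem {f g : G → K} (hf : f ∈ steinbergSubmodule K G)
    (hg : g ∈ steinbergSubmodule K G) : convolution f g ∈ steinbergSubmodule K G := by
  induction hf using Submodule.span_induction with
  | mem f hf =>
    obtain ⟨U, hUc, hU, rfl⟩ := hf
    induction hg using Submodule.span_induction with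
    | mem g hg =>
      obtain ⟨V, hVc, hV, rfl⟩ := hg
      rw [convolution_charFn hU]
      exact charFn_mem (isCompact_setMul hUc hVc) (isLocalBisection_setMul hU hV)
    | zero => rw [convolution_zero_right]; exact zero_mem _
    | add g g' _ _ h h' =>
      rw [convolution_add_right (charFn_mem hUc hU)]; exact add_mem h h'
    | smul c g _ h =>
      rw [convolution_smul_right c (charFn_mem hUc hU)]; exact Submodule.smul_mem _ c h
  | zero => rw [convolution_zero_left]; exact zero_mem _
  | add f f' hf hf' h h' => rw [convolution_add_left hf hf']; exact add_mem h h'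
  | smul c f hf h => rw [convolution_smul_left c hf]; exact Submodule.smul_mem _ c h

theorem convolution_assoc {f g h : G → K} (hf : f ∈ steinbergSubmodule K G)
    (hg : g ∈ steinbergSubmodule K G) (hh : h ∈ steinbergSubmodule K G) :
    convolution (convolution f g) h = convolution f (convolution g h) := by
  induction hf using Submodule.span_induction with
  | mem f hf =>
    obtain ⟨U, hUc, hU, rfl⟩ := hf
    have mU := charFn_mem (K := K) hUc hU
    induction hg using Submodule.span_induction with
    | mem g hg =>
      obtain ⟨V, hVc, hV, rfl⟩ := hg
      have mV := charFn_mem (K := K) hVc hV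
      have mUV := convolution_mem mU mV
      induction hh using Submodule.span_induction with
      | mem h hh =>
        obtain ⟨W, hWc, hW, rfl⟩ := hh
        rw [convolution_charFn hU, convolution_charFn (isLocalBisection_setMul hU hV),
          convolution_charFn hV, convolution_charFn hU, setMul_assoc]
      | zero => simp only [convolution_zero_right]
      | add h h' mh mh' e e' =>
        rw [convolution_add_right mUV, convolution_add_right mV, convolution_add_right mU, e, e']
      | smul c h mh e =>
        rw [convolution_smul_right c mUV, convolution_smul_right c mV,
          convolution_smul_right c mU, e]
    | zero => simp only [convolution_zero_right, convolution_zero_left]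
    | add g g' mg mg' e e' =>
      rw [convolution_add_right mU, convolution_add_left mg mg',
        convolution_add_left (convolution_mem mU mg) (convolution_mem mU mg'),
        convolution_add_right mU, e, e']
    | smul c g mg e =>
      rw [convolution_smul_right c mU, convolution_smul_left c mg,
        convolution_smul_left c (convolution_mem mU mg), convolution_smul_right c mU, e]
  | zero => simp only [convolution_zero_left]
  | add f f' mf mf' e e' =>
    rw [convolution_add_left mf mf', convolution_add_left mf mf',
      convolution_add_left (convolution_mem mf hg) (convolution_mem mf' hg), e, e']
  | smul c f mf e =>
    rw [convolution_smul_left c mf, convolution_smul_left c mf,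
      convolution_smul_left c (convolution_mem mf hg), e]

end Convolution

end ArrowGroupoid

namespace SteinbergAlgebra

section Basic

variable {K G : Type*} [CommRing K] [TopologicalSpace G] [ArrowGroupoid G]

instance : AddCommGroup (SteinbergAlgebra K G) :=
  inferInstanceAs (AddCommGroup (steinbergSubmodule K G))

instance : Module K (SteinbergAlgebra K G) :=
  inferInstanceAs (Module K (steinbergSubmodule K G))

/-- The function from `G` to `K` underlying an element of the Steinberg algebra. -/
def toFun (f : SteinbergAlgebra K G) : G → K := Subtype.val f

instance : CoeFun (SteinbergAlgebra K G) (fun _ => G → K) := ⟨toFun⟩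

/-- An element of the Steinberg algebra, from its underlying function. -/
def ofFun (f : G → K) (hf : f ∈ steinbergSubmodule K G) : SteinbergAlgebra K G := ⟨f, hf⟩

theorem ext_toFun {f g : SteinbergAlgebra K G} (h : f.toFun = g.toFun) : f = g := Subtype.ext h

end Basic

variable {K G : Type*} [CommRing K] [TopologicalSpace G] [ArrowGroupoid G] [IsEtaleGroupoid G]

noncomputable instance : Mul (SteinbergAlgebra K G) :=
  ⟨fun f g => ⟨convolution f.toFun g.toFun, convolution_mem f.2 g.2⟩⟩

noncomputable instance : NonUnitalRing (SteinbergAlgebra K G) where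
  left_distrib f g h := ext_toFun (convolution_add_right f.2 g.toFun h.toFun)
  right_distrib f g h := ext_toFun (convolution_add_left f.2 g.2 h.toFun)
  zero_mul g := ext_toFun (convolution_zero_left g.toFun)
  mul_zero f := ext_toFun (convolution_zero_right f.toFun)
  mul_assoc f g h := ext_toFun (convolution_assoc f.2 g.2 h.2)

instance : IsScalarTower K (SteinbergAlgebra K G) (SteinbergAlgebra K G) :=
  ⟨fun c f g => ext_toFun (convolution_smul_left c f.2 g.toFun)⟩

instance : SMulCommClass K (SteinbergAlgebra K G) (SteinbergAlgebra K G) :=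
  ⟨fun c f g => ext_toFun (convolution_smul_right c f.2 g.toFun).symm⟩

/-- The characteristic function `χ_U` of a compact open subset `U` of the unit space, as an element
of the Steinberg algebra. -/
noncomputable def unitChar (K : Type*) {G : Type*} [CommRing K] [TopologicalSpace G]
    [ArrowGroupoid G] [IsEtaleGroupoid G] (U : TopologicalSpace.CompactOpens (UnitSpace G)) :
    SteinbergAlgebra K G :=
  ofFun (charFn K (Subtype.val '' (U : Set (UnitSpace G))))
    (charFn_mem (U.isCompact.image continuous_subtype_val)
      (isLocalBisection_image_units U.isOpen))

/-- An element of the Steinberg algebra is singular if its support (no closure is taken) has empty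
interior. -/
def IsSingular (f : SteinbergAlgebra K G) : Prop := interior {γ | f γ ≠ 0} = ∅

theorem isSingular_iff {f : SteinbergAlgebra K G} :
    f.IsSingular ↔ ∀ W : Set G, IsOpen W → W.Nonempty → ∃ γ ∈ W, f γ = 0 := by
  constructor
  · rintro h W hW ⟨x, hx⟩
    by_contra! hn
    have : x ∈ interior {γ | f γ ≠ 0} := mem_interior.2 ⟨W, fun γ hγ => hn γ hγ, hW, hx⟩
    rw [IsSingular] at h
    simp [h] at this
  · intro h
    by_contra hn
    obtain ⟨γ, hγ, h0⟩ := h _ isOpen_interior (nonempty_iff_ne_empty.2 hn)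
    exact interior_subset hγ h0

theorem exists_const {f : G → K} (hf : f ∈ steinbergSubmodule K G) :
    ∀ W : Set G, IsOpen W → W.Nonempty →
      ∃ V ⊆ W, IsOpen V ∧ V.Nonempty ∧ ∃ c, ∀ γ ∈ V, f γ = c := by
  induction hf using Submodule.span_induction with
  | mem f hf =>
    obtain ⟨U, -, hU, rfl⟩ := hf
    intro W hW hne
    by_cases h : (W ∩ U).Nonempty
    · exact ⟨W ∩ U, inter_subset_left, hW.inter hU.isOpen, h, 1,
        fun γ hγ => indicator_of_mem hγ.2 _⟩
    · exact ⟨W, Subset.rfl, hW, hne, 0,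
        fun γ hγ => indicator_of_notMem (fun hU => h ⟨γ, hγ, hU⟩) _⟩
  | zero => exact fun W hW hne => ⟨W, Subset.rfl, hW, hne, 0, fun _ _ => rfl⟩
  | add f g _ _ hf hg =>
    intro W hW hne
    obtain ⟨V, hVW, hV, hVne, c, hc⟩ := hf W hW hne
    obtain ⟨V', hV', hVo, hVne', c', hc'⟩ := hg V hV hVne
    exact ⟨V', hV'.trans hVW, hVo, hVne', c + c',
      fun γ hγ => by simp [hc γ (hV' hγ), hc' γ hγ]⟩
  | smul a f _ hf =>
    intro W hW hne
    obtain ⟨V, hVW, hV, hVne, c, hc⟩ := hf W hW hne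
    exact ⟨V, hVW, hV, hVne, a * c, fun γ hγ => by simp [hc γ hγ]⟩

theorem isSingular_zero : (0 : SteinbergAlgebra K G).IsSingular :=
  isSingular_iff.2 fun _ _ ⟨x, hx⟩ => ⟨x, hx, rfl⟩

theorem IsSingular.add {f g : SteinbergAlgebra K G} (hf : f.IsSingular) (hg : g.IsSingular) :
    (f + g).IsSingular := by
  rw [isSingular_iff] at *
  intro W hW hne
  obtain ⟨V, hVW, hV, hVne, c, hc⟩ := exists_const f.2 W hW hne
  obtain ⟨x, hx, hx0⟩ := hf V hV hVne
  obtain ⟨y, hy, hy0⟩ := hg V hV hVne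
  refine ⟨y, hVW hy, ?_⟩
  have h1 : f y = 0 := (hc y hy).trans ((hc x hx).symm.trans hx0)
  change f y + g y = 0
  rw [h1, hy0, add_zero]

theorem IsSingular.smul (c : K) {f : SteinbergAlgebra K G} (hf : f.IsSingular) :
    (c • f).IsSingular := by
  rw [isSingular_iff] at *
  intro W hW hne
  obtain ⟨x, hx, hx0⟩ := hf W hW hne
  refine ⟨x, hx, ?_⟩
  change c * f x = 0
  rw [hx0, mul_zero]

theorem IsSingular.neg {f : SteinbergAlgebra K G} (hf : f.IsSingular) : (-f).IsSingular := by
  simpa using hf.smul (-1)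

theorem isOpen_image_inv {U : Set G} (hU : IsOpen U) : IsOpen (inv '' U) := by
  have : inv '' U = inv ⁻¹' U := by
    ext g
    constructor
    · rintro ⟨u, hu, rfl⟩
      simpa [ArrowGroupoid.inv_inv] using hu
    · exact fun h => ⟨inv g, h, ArrowGroupoid.inv_inv g⟩
  rw [this]
  exact hU.preimage IsTopologicalGroupoid.continuous_inv

theorem IsSingular.mul_left (g : SteinbergAlgebra K G) {f : SteinbergAlgebra K G}
    (hf : f.IsSingular) : (g * f).IsSingular := by
  obtain ⟨g, hg⟩ := g
  induction hg using Submodule.span_induction with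
  | zero =>
    have h : ((0 : SteinbergAlgebra K G) * f).IsSingular := by
      rw [zero_mul]; exact isSingular_zero
    exact h
  | add g g' hg hg' h h' =>
    change ((ofFun g hg + ofFun g' hg') * f).IsSingular
    rw [add_mul]
    exact IsSingular.add h h'
  | smul c g hg h =>
    change ((c • ofFun g hg) * f).IsSingular
    rw [smul_mul_assoc]
    exact IsSingular.smul c h
  | mem g hg =>
    obtain ⟨U, hUc, hU, rfl⟩ := hg
    have hU' := isLocalBisection_iff.1 hU
    rw [isSingular_iff] at *
    intro W hW hne
    by_contra! hn
    have key : ∀ γ ∈ W, ∃ u ∈ U, rng u = rng γ := by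
      intro γ hγ
      by_contra! h
      refine hn γ hγ (finsum_eq_zero_of_forall_eq_zero ?_)
      rintro ⟨⟨⟨a, b⟩, hc⟩, rfl⟩
      have : a ∉ U := fun ha => h a ha (rng_comp a b hc).symm
      simp [toFun, charFn, this]
    obtain ⟨γ, hγ⟩ := hne
    obtain ⟨u, hu, hur⟩ := key γ hγ
    obtain ⟨δ, ⟨_, ⟨v, hv, rfl⟩, w, hw, hc, rfl⟩, h0⟩ := hf (setMul (inv '' U) W)
      (isOpen_setMul (isOpen_image_inv hU.isOpen) hW)
      ⟨_, inv u, ⟨u, hu, rfl⟩, γ, hγ, (dom_inv u).trans hur, rfl⟩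
    refine hn w hw (finsum_eq_zero_of_forall_eq_zero ?_)
    rintro ⟨⟨⟨a, b⟩, hab⟩, rfl⟩
    by_cases ha : a ∈ U
    · have hvr : rng a = rng v := by
        rw [← rng_comp a b hab, ← hc, dom_inv]
      obtain rfl := hU'.2.2 ha hv hvr
      rw [inv_comp_cancel] at h0
      simp [h0]
    · simp [toFun, charFn, ha]

theorem IsSingular.mul_right (g : SteinbergAlgebra K G) {f : SteinbergAlgebra K G}
    (hf : f.IsSingular) : (f * g).IsSingular := by
  obtain ⟨g, hg⟩ := g
  induction hg using Submodule.span_induction with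
  | zero =>
    have h : (f * (0 : SteinbergAlgebra K G)).IsSingular := by
      rw [mul_zero]; exact isSingular_zero
    exact h
  | add g g' hg hg' h h' =>
    change (f * (ofFun g hg + ofFun g' hg')).IsSingular
    rw [mul_add]
    exact IsSingular.add h h'
  | smul c g hg h =>
    change (f * (c • ofFun g hg)).IsSingular
    rw [mul_smul_comm]
    exact IsSingular.smul c h
  | mem g hg =>
    obtain ⟨U, hUc, hU, rfl⟩ := hg
    have hU' := isLocalBisection_iff.1 hU
    rw [isSingular_iff] at *
    intro W hW hne
    by_contra! hn
    have key : ∀ γ ∈ W, ∃ u ∈ U, dom u = dom γ := by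
      intro γ hγ
      by_contra! h
      refine hn γ hγ (finsum_eq_zero_of_forall_eq_zero ?_)
      rintro ⟨⟨⟨a, b⟩, hc⟩, rfl⟩
      have : b ∉ U := fun hb => h b hb (dom_comp a b hc).symm
      simp [toFun, charFn, this]
    obtain ⟨γ, hγ⟩ := hne
    obtain ⟨u, hu, hud⟩ := key γ hγ
    obtain ⟨δ, ⟨w, hw, _, ⟨v, hv, rfl⟩, hc, rfl⟩, h0⟩ := hf (setMul W (inv '' U))
      (isOpen_setMul hW (isOpen_image_inv hU.isOpen))
      ⟨_, γ, hγ, inv u, ⟨u, hu, rfl⟩, hud.symm.trans (rng_inv u).symm, rfl⟩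
    refine hn w hw (finsum_eq_zero_of_forall_eq_zero ?_)
    rintro ⟨⟨⟨a, b⟩, hab⟩, rfl⟩
    by_cases hb : b ∈ U
    · have hvd : dom b = dom v := by
        rw [← dom_comp a b hab, hc, rng_inv]
      obtain rfl := hU'.2.1 hb hv hvd
      rw [comp_inv_cancel_right] at h0
      simp [h0]
    · simp [toFun, charFn, hb]

end SteinbergAlgebra

/-- The ideal of singular functions in the Steinberg algebra. -/
noncomputable def singularIdeal (K G : Type*) [CommRing K] [TopologicalSpace G] [ArrowGroupoid G]
    [IsEtaleGroupoid G] : TwoSidedIdeal (SteinbergAlgebra K G) :=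
  TwoSidedIdeal.mk' {f | f.IsSingular} SteinbergAlgebra.isSingular_zero
    (fun hf hg => hf.add hg) (fun hf => hf.neg) (fun hf => hf.mul_left _)
    (fun hf => hf.mul_right _)

/-- The essential algebra: the quotient of the Steinberg algebra by the ideal of singular
functions. -/
abbrev EssentialAlgebra (K G : Type*) [CommRing K] [TopologicalSpace G] [ArrowGroupoid G]
    [IsEtaleGroupoid G] : Type _ :=
  (singularIdeal K G).ringCon.Quotient

/-- The coset of an element of the Steinberg algebra in the essential algebra. -/
noncomputable def SteinbergAlgebra.coset {K G : Type*} [CommRing K] [TopologicalSpace G] [ArrowGroupoid G]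
    [IsEtaleGroupoid G] (f : SteinbergAlgebra K G) : EssentialAlgebra K G :=
  (f : (singularIdeal K G).ringCon.Quotient)

namespace EssentialAlgebra

variable {K G : Type*} [CommRing K] [TopologicalSpace G] [ArrowGroupoid G] [IsEtaleGroupoid G]

/-- Scalar multiplication on the essential algebra, induced from the Steinberg algebra. -/
noncomputable instance : SMul K (EssentialAlgebra K G) :=
  ⟨fun c => Quotient.map (fun f => c • f) fun f g h => by
    have h' : f - g ∈ singularIdeal K G := ((singularIdeal K G).rel_iff f g).1 h
    refine ((singularIdeal K G).rel_iff (c • f) (c • g)).2 ?_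
    rw [← smul_sub]
    rw [singularIdeal, TwoSidedIdeal.mem_mk'] at h' ⊢
    exact SteinbergAlgebra.IsSingular.smul c h'⟩

noncomputable instance : Module K (EssentialAlgebra K G) :=
  Function.Surjective.module K
    (⟨⟨SteinbergAlgebra.coset, rfl⟩, fun _ _ => rfl⟩ : SteinbergAlgebra K G →+ EssentialAlgebra K G)
    Quotient.mk_surjective (fun _ _ => rfl)

instance : IsScalarTower K (EssentialAlgebra K G) (EssentialAlgebra K G) where
  smul_assoc c := by
    rintro ⟨f⟩ ⟨g⟩
    exact congrArg SteinbergAlgebra.coset (smul_mul_assoc c f g)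

instance : SMulCommClass K (EssentialAlgebra K G) (EssentialAlgebra K G) where
  smul_comm c := by
    rintro ⟨f⟩ ⟨g⟩
    exact congrArg SteinbergAlgebra.coset (mul_smul_comm c f g).symm

end EssentialAlgebra

/-! The heart of the proof is that a non-singular `f` can be multiplied on both sides to give
exactly `χ_U`, an equality in `KG` itself and not only modulo singular functions. A non-singular `f`
is nowhere zero on some non-empty open set. Since `f` is a finite combination of characteristic
functions of bisections, it is constant, with value `c ≠ 0`, on a smaller one (`exists_const`),
which contains a non-empty compact local bisection `V`. Multiplying on the left by the
characteristic function `s` of `V⁻¹` moves the value at `v` to the unit `d(v) = v⁻¹v`, so `s * f`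
equals `c` on the open set `d(V)` of units. Topological freeness then gives a non-empty open `O ⊆
d(V)` such that `s * f` vanishes at every non-identity arrow with both ends in `O`
(`exists_eq_zero_off_units`). Only finitely many bisections are involved, so successive shrinking
suffices and no Baire argument is needed. Cutting down by `χ_U` on both sides, for a compact open `U
⊆ O`, leaves `c χ_U`. A non-zero coset has a non-singular representative. In the Hausdorff case
every non-zero function is non-singular, being locally constant. -/

namespace ArrowGroupoid

/-! ### Values of convolutions with characteristic functions of bisections -/

section ConvolutionValues

variable {K G : Type*} [CommRing K] [ArrowGroupoid G]

/-- Injectivity of the range map on `U` and cancellation leave one factorisation of `ub` with first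
factor in `U`, so the sum has a single term. Convolution by a bisection thus merely translates `g`.
-/
theorem convolution_charFn_left_apply {U : Set G} (hU : InjOn (rng : G → G) U) (g : G → K)
    {u b : G} (hu : u ∈ U) (hc : dom u = rng b) :
    convolution (charFn K U) g (comp u b hc) = g b := by
  rw [convolution, finsum_eq_single _ ⟨⟨(u, b), hc⟩, rfl⟩]
  · simp [charFn, hu]
  · rintro ⟨⟨⟨a, b'⟩, hc'⟩, h'⟩ hne
    by_cases ha : a ∈ U
    · exfalso
      apply hne
      have hr : rng a = rng u := by
        rw [← rng_comp a b' hc', h', rng_comp]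
      obtain rfl := hU ha hu hr
      obtain rfl := comp_left_cancel h'
      rfl
    · simp [charFn, ha]

theorem convolution_charFn_left_eq_zero {U : Set G} (g : G → K) {γ : G}
    (h : ∀ u ∈ U, rng u ≠ rng γ) : convolution (charFn K U) g γ = 0 := by
  refine finsum_eq_zero_of_forall_eq_zero ?_
  rintro ⟨⟨⟨a, b⟩, hc⟩, rfl⟩
  have ha : a ∉ U := fun ha => h a ha (rng_comp a b hc).symm
  simp [charFn, ha]

theorem convolution_charFn_right_apply {U : Set G} (hU : InjOn (dom : G → G) U) (g : G → K)
    {a u : G} (hu : u ∈ U) (hc : dom a = rng u) :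
    convolution g (charFn K U) (comp a u hc) = g a := by
  rw [convolution, finsum_eq_single _ ⟨⟨(a, u), hc⟩, rfl⟩]
  · simp [charFn, hu]
  · rintro ⟨⟨⟨a', b⟩, hc'⟩, h'⟩ hne
    by_cases hb : b ∈ U
    · exfalso
      apply hne
      have hd : dom b = dom u := by
        rw [← dom_comp a' b hc', h', dom_comp]
      obtain rfl := hU hb hu hd
      obtain rfl := comp_right_cancel h'
      rfl
    · simp [charFn, hb]

theorem convolution_charFn_right_eq_zero {U : Set G} (g : G → K) {γ : G}
    (h : ∀ u ∈ U, dom u ≠ dom γ) : convolution g (charFn K U) γ = 0 := by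
  refine finsum_eq_zero_of_forall_eq_zero ?_
  rintro ⟨⟨⟨a, b⟩, hc⟩, rfl⟩
  have hb : b ∉ U := fun hb => h b hb (dom_comp a b hc).symm
  simp [charFn, hb]

theorem injOn_dom_units : InjOn (dom : G → G) (units G) := fun a ha b hb h => by
  rw [← show dom a = a from ha, h, show dom b = b from hb]

theorem injOn_rng_units : InjOn (rng : G → G) (units G) := fun a ha b hb h => by
  rw [← rng_eq_of_mem_units ha, h, rng_eq_of_mem_units hb]

-- For a set of units the only relevant factorisation is `γ = r(γ)γ`, so convolution is restriction
-- to arrows with range in `U`. Together with the right-hand version it cuts a function down to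
-- arrows with both ends in `U`.
open Classical in
theorem convolution_charFn_units_left (U : Set (UnitSpace G)) (g : G → K) (γ : G) :
    convolution (charFn K (Subtype.val '' U : Set G)) g γ = if rngU γ ∈ U then g γ else 0 := by
  split_ifs with h
  · conv_lhs => rw [← rng_id_comp γ]
    exact convolution_charFn_left_apply (injOn_rng_units.mono (Subtype.coe_image_subset _ _)) g
      ⟨_, h, rfl⟩ _
  · refine convolution_charFn_left_eq_zero g ?_
    rintro _ ⟨x, hx, rfl⟩ e
    rw [rng_eq_of_mem_units x.2] at e
    exact h ((Subtype.ext e : x = rngU γ) ▸ hx)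

open Classical in
theorem convolution_charFn_units_right (U : Set (UnitSpace G)) (g : G → K) (γ : G) :
    convolution g (charFn K (Subtype.val '' U : Set G)) γ = if domU γ ∈ U then g γ else 0 := by
  split_ifs with h
  · conv_lhs => rw [← comp_dom_id γ]
    exact convolution_charFn_right_apply (injOn_dom_units.mono (Subtype.coe_image_subset _ _)) g
      ⟨_, h, rfl⟩ _
  · refine convolution_charFn_right_eq_zero g ?_
    rintro _ ⟨x, hx, rfl⟩ e
    rw [show dom x.1 = x.1 from x.2] at e
    exact h ((Subtype.ext e : x = domU γ) ▸ hx)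

end ConvolutionValues

/-! ### Compact open sets of units and compact local bisections -/

section Ample

variable {G : Type*} [TopologicalSpace G] [ArrowGroupoid G]

theorem IsLocalBisection.image_inv [IsEtaleGroupoid G] {U : Set G} (hU : IsLocalBisection U) :
    IsLocalBisection (inv '' U) := by
  rw [isLocalBisection_iff] at *
  refine ⟨SteinbergAlgebra.isOpen_image_inv hU.1, ?_, ?_⟩
  · rintro _ ⟨a, ha, rfl⟩ _ ⟨b, hb, rfl⟩ h
    rw [dom_inv, dom_inv] at h
    rw [hU.2.2 ha hb h]
  · rintro _ ⟨a, ha, rfl⟩ _ ⟨b, hb, rfl⟩ h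
    rw [rng_inv, rng_inv] at h
    rw [hU.2.1 ha hb h]

variable [IsAmpleGroupoid G]

theorem exists_compactOpens_subset {O : Set (UnitSpace G)} (hO : IsOpen O) (hne : O.Nonempty) :
    ∃ U : TopologicalSpace.CompactOpens (UnitSpace G),
      (U : Set (UnitSpace G)).Nonempty ∧ (U : Set (UnitSpace G)) ⊆ O := by
  obtain ⟨x, hx⟩ := hne
  obtain ⟨U, ⟨hc, ho⟩, hxU, hUO⟩ :=
    IsAmpleGroupoid.isTopologicalBasis_units.exists_subset_of_mem_open hx hO
  exact ⟨⟨⟨U, hc⟩, ho⟩, ⟨x, hxU⟩, hUO⟩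

/-- A compact open set of units is lifted through a local inverse of `d`. It is chosen so small that
the lift also lies in a chart of `r`, which makes `r` injective on it. -/
theorem exists_compact_isLocalBisection_subset {W : Set G} (hW : IsOpen W) (hne : W.Nonempty) :
    ∃ V ⊆ W, V.Nonempty ∧ IsCompact V ∧ IsLocalBisection V := by
  obtain ⟨w, hw⟩ := hne
  obtain ⟨e, hwe, he⟩ := (IsEtaleGroupoid.isLocalHomeomorph_domU (G := G)) w
  obtain ⟨e', hwe', he'⟩ := (isLocalHomeomorph_rngU (G := G)) w
  have hs : e.source ∩ (e'.source ∩ W) ⊆ e.source := inter_subset_left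
  obtain ⟨C, ⟨y, hy⟩, hCO⟩ := exists_compactOpens_subset
    (e.isOpen_image_of_subset_source
      (e.open_source.inter (e'.open_source.inter hW)) hs) ⟨_, w, ⟨hwe, hwe', hw⟩, rfl⟩
  have hCt : (C : Set (UnitSpace G)) ⊆ e.target :=
    hCO.trans ((image_mono hs).trans e.image_source_eq_target.subset)
  have hsub : e.symm '' (C : Set (UnitSpace G)) ⊆ e.source ∩ (e'.source ∩ W) := by
    rintro _ ⟨z, hz, rfl⟩
    obtain ⟨g, hg, rfl⟩ := hCO hz
    rwa [e.left_inv hg.1]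
  refine ⟨e.symm '' (C : Set (UnitSpace G)), fun g hg => (hsub hg).2.2, ⟨_, y, hy, rfl⟩,
    C.isCompact.image_of_continuousOn (e.continuousOn_symm.mono hCt), ?_⟩
  rw [isLocalBisection_iff]
  refine ⟨e.symm.isOpen_image_of_subset_source C.isOpen hCt, fun a ha b hb h => ?_,
    fun a ha b hb h => ?_⟩
  · refine e.injOn (hsub ha).1 (hsub hb).1 ?_
    rw [← he]
    exact Subtype.ext h
  · refine e'.injOn (hsub ha).2.1 (hsub hb).2.1 ?_
    rw [← he']
    exact Subtype.ext h

end Ample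

/-! ### Shrinking with topological freeness; local constancy in the Hausdorff case -/

section TopologicallyFree

variable {K G : Type*} [CommRing K] [TopologicalSpace G] [ArrowGroupoid G] [IsEtaleGroupoid G]

/-- In a topologically free groupoid every nonempty open set of units can be shrunk so that a given
local bisection contains no non-identity arrow between points of the smaller set. -/
theorem IsTopologicallyFree.exists_shrink (hG : IsTopologicallyFree G) {U : Set G}
    (hU : IsLocalBisection U) {O : Set (UnitSpace G)} (hO : IsOpen O) (hne : O.Nonempty) :
    ∃ O' ⊆ O, IsOpen O' ∧ O'.Nonempty ∧
      ∀ γ ∈ U, domU γ ∈ O' → rngU γ ∈ O' → γ ∈ units G := by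
  have := IsEtaleGroupoid.t2Space_units (G := G)
  have hU' := isLocalBisection_iff.1 hU
  -- Either the part of `U` over `O` is isotropy, and topological freeness puts a unit in it unless
  -- it is empty, or some arrow of `U` moves its source, and the Hausdorff property of the unit
  -- space applies.
  by_cases hfix : ∀ γ ∈ U, domU γ ∈ O → domU γ = rngU γ
  · by_cases hemp : ∃ γ ∈ U, domU γ ∈ O
    · obtain ⟨γ, hγ, hγO⟩ := hemp
      have hW : IsOpen (U ∩ domU ⁻¹' O) := hU.isOpen.inter (hO.preimage continuous_domU)
      have hx : ∃ x ∈ U ∩ domU ⁻¹' O, x ∈ units G := by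
        by_contra! hn
        have hsub : U ∩ domU ⁻¹' O ⊆ isotropy G \ units G := fun g hg =>
          ⟨congrArg Subtype.val (hfix g hg.1 hg.2), hn g hg⟩
        have hmem : γ ∈ interior (isotropy G \ units G) :=
          mem_interior.2 ⟨_, hsub, hW, hγ, hγO⟩
        rw [IsTopologicallyFree] at hG
        simp [hG] at hmem
      obtain ⟨x, ⟨hxU, hxO⟩, hx⟩ := hx
      have hdx : domU x = ⟨x, hx⟩ := Subtype.ext hx
      -- The units lying in `U` itself: if `g` and `d(g)` are both in `U`, they have the same
      -- domain, so injectivity of `d` on `U` forces `g = d(g)`.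
      refine ⟨O ∩ Subtype.val ⁻¹' U, inter_subset_left,
        hO.inter (hU.isOpen.preimage continuous_subtype_val), ⟨⟨x, hx⟩, hdx ▸ hxO, hxU⟩, ?_⟩
      intro g hg hgO _
      exact hU'.2.1 hgO.2 hg (dom_dom g)
    · exact ⟨O, Subset.rfl, hO, hne, fun γ hγ hγO _ => (hemp ⟨γ, hγ, hγO⟩).elim⟩
  · push Not at hfix
    obtain ⟨γ, hγ, hγO, hγne⟩ := hfix
    obtain ⟨A, B, hA, hB, hγA, hγB, hAB⟩ := t2_separation hγne
    have hW : IsOpen (U ∩ rngU ⁻¹' B) := hU.isOpen.inter (hB.preimage continuous_rngU)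
    -- An arrow of `U` starting in this set ends in `B`, by injectivity of `d` on `U`, hence not in
    -- `A`; so no arrow of `U` has both ends in the set.
    refine ⟨O ∩ A ∩ domU '' (U ∩ rngU ⁻¹' B), fun x hx => hx.1.1,
      (hO.inter hA).inter (IsEtaleGroupoid.isLocalHomeomorph_domU.isOpenMap _ hW),
      ⟨domU γ, ⟨hγO, hγA⟩, γ, ⟨hγ, hγB⟩, rfl⟩, ?_⟩
    rintro g hg ⟨-, g', ⟨hg', hgB⟩, e⟩ ⟨⟨-, hgA⟩, -⟩
    obtain rfl := hU'.2.1 hg' hg (congrArg Subtype.val e)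
    exact (disjoint_left.1 hAB hgA hgB).elim

/-- The vanishing condition passes to smaller sets `O'`. Quantifying over every `O` therefore lets
the induction over the span shrink for one summand inside the set found for the other. -/
theorem IsTopologicallyFree.exists_eq_zero_off_units (hG : IsTopologicallyFree G) {f : G → K}
    (hf : f ∈ steinbergSubmodule K G) :
    ∀ O : Set (UnitSpace G), IsOpen O → O.Nonempty →
      ∃ O' ⊆ O, IsOpen O' ∧ O'.Nonempty ∧
        ∀ γ, domU γ ∈ O' → rngU γ ∈ O' → γ ∉ units G → f γ = 0 := by
  induction hf using Submodule.span_induction with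
  | mem f hf =>
    obtain ⟨U, -, hU, rfl⟩ := hf
    intro O hO hne
    obtain ⟨O', h1, h2, h3, h4⟩ := hG.exists_shrink hU hO hne
    exact ⟨O', h1, h2, h3, fun γ hd hr hu => indicator_of_notMem (fun h => hu (h4 γ h hd hr)) _⟩
  | zero => exact fun O hO hne => ⟨O, Subset.rfl, hO, hne, fun _ _ _ _ => rfl⟩
  | add f g _ _ hf hg =>
    intro O hO hne
    obtain ⟨O₁, h1, h2, h3, h4⟩ := hf O hO hne
    obtain ⟨O₂, k1, k2, k3, k4⟩ := hg O₁ h2 h3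
    exact ⟨O₂, k1.trans h1, k2, k3, fun γ hd hr hu => by
      simp [h4 γ (k1 hd) (k1 hr) hu, k4 γ hd hr hu]⟩
  | smul c f _ hf =>
    intro O hO hne
    obtain ⟨O₁, h1, h2, h3, h4⟩ := hf O hO hne
    exact ⟨O₁, h1, h2, h3, fun γ hd hr hu => by simp [h4 γ hd hr hu]⟩

/-- Over a Hausdorff groupoid the elements of the Steinberg algebra are locally constant. -/
theorem eventually_eq_of_mem_steinbergSubmodule [T2Space G] {f : G → K}
    (hf : f ∈ steinbergSubmodule K G) : ∀ x, ∀ᶠ y in 𝓝 x, f y = f x := by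
  induction hf using Submodule.span_induction with
  | mem f hf =>
    obtain ⟨U, hUc, hU, rfl⟩ := hf
    intro x
    by_cases hx : x ∈ U
    · filter_upwards [hU.isOpen.mem_nhds hx] with y hy
      simp [charFn, hx, hy]
    -- The Hausdorff hypothesis enters here: the compact set `U` is closed.
    · filter_upwards [hUc.isClosed.isOpen_compl.mem_nhds hx] with y hy
      have hy' : y ∉ U := hy
      simp [charFn, hx, hy']
  | zero => simp
  | add f g _ _ hf hg =>
    intro x
    filter_upwards [hf x, hg x] with y h1 h2
    simp [h1, h2]
  | smul c f _ hf =>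
    intro x
    filter_upwards [hf x] with y h1
    simp [h1]

end TopologicallyFree

end ArrowGroupoid

/-! ### From a non-singular function to the characteristic function of a set of units -/

namespace SteinbergAlgebra

variable {K G : Type*} [Field K] [TopologicalSpace G] [ArrowGroupoid G]

/-- A locally constant function has open support, so empty interior would mean empty support. -/
theorem not_isSingular_of_ne_zero [IsEtaleGroupoid G] [T2Space G] {f : SteinbergAlgebra K G}
    (hf : f ≠ 0) : ¬ f.IsSingular := by
  intro hs
  obtain ⟨x, hx⟩ : ∃ x, f x ≠ 0 := by
    by_contra! h
    exact hf (ext_toFun (funext h))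
  have hmem : x ∈ interior {γ | f γ ≠ 0} := by
    rw [mem_interior_iff_mem_nhds]
    filter_upwards [eventually_eq_of_mem_steinbergSubmodule f.2 x] with y hy
    exact fun h => hx (hy.symm.trans h)
  rw [IsSingular] at hs
  simp [hs] at hmem

/-- Over a topologically free ample groupoid, `χ_U` for some nonempty compact open set `U` of units
can be obtained from any non-singular element by multiplying on both sides. -/
theorem exists_mul_mul_eq_unitChar [IsAmpleGroupoid G] (hG : IsTopologicallyFree G)
    {f : SteinbergAlgebra K G} (hf : ¬ f.IsSingular) :
    ∃ U : TopologicalSpace.CompactOpens (UnitSpace G), (U : Set (UnitSpace G)).Nonempty ∧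
      ∃ a b : SteinbergAlgebra K G, a * f * b = unitChar K U := by
  classical
  rw [isSingular_iff] at hf
  push Not at hf
  obtain ⟨W, hW, hWne, hWf⟩ := hf
  obtain ⟨W', hW'W, hW', hW'ne, c, hc⟩ := exists_const f.2 W hW hWne
  have hc0 : c ≠ 0 := by
    obtain ⟨x, hx⟩ := hW'ne
    rw [← hc x hx]
    exact hWf x (hW'W hx)
  obtain ⟨V, hVW, hVne, hVc, hV⟩ := exists_compact_isLocalBisection_subset hW' hW'ne
  let s : SteinbergAlgebra K G := ofFun (charFn K (inv '' V))
    (charFn_mem (hVc.image IsTopologicalGroupoid.continuous_inv) hV.image_inv)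
  have hs : ∀ v ∈ V, (s * f) (dom v) = c := by
    intro v hv
    rw [← hc v (hVW hv), ← inv_comp v]
    exact convolution_charFn_left_apply (isLocalBisection_iff.1 hV.image_inv).2.2 f.toFun
      ⟨v, hv, rfl⟩ (dom_inv v)
  obtain ⟨O, hOV, hO, hOne, hO0⟩ := hG.exists_eq_zero_off_units (s * f).2 (domU '' V)
    (IsEtaleGroupoid.isLocalHomeomorph_domU.isOpenMap _ hV.isOpen) (hVne.image _)
  obtain ⟨U, hUne, hUO⟩ := exists_compactOpens_subset hO hOne
  -- The left factor carries `V` to units and cuts ranges down to `U`; the right factor cuts domains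
  -- down and normalises the value `c`, which is where `K` being a field is used.
  refine ⟨U, hUne, unitChar K U * s, c⁻¹ • unitChar K U, ?_⟩
  rw [mul_smul_comm, mul_assoc (unitChar K U)]
  refine ext_toFun (funext fun γ => ?_)
  have hval : (c⁻¹ • (unitChar K U * (s * f) * unitChar K U)).toFun γ =
      c⁻¹ * if domU γ ∈ (U : Set (UnitSpace G)) then
        (if rngU γ ∈ (U : Set (UnitSpace G)) then (s * f) γ else 0) else 0 := by
    rw [← convolution_charFn_units_left, ← convolution_charFn_units_right]
    rfl
  rw [hval]
  change _ = charFn K (Subtype.val '' (U : Set (UnitSpace G))) γ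
  -- At units the value comes from `hs`, since `U ⊆ d(V)`; elsewhere the choice of `O` makes the
  -- compressed function vanish.
  by_cases hγ : γ ∈ units G
  · have hd : domU γ = ⟨γ, hγ⟩ := Subtype.ext hγ
    have hr : rngU γ = ⟨γ, hγ⟩ := Subtype.ext (rng_eq_of_mem_units hγ)
    rw [hd, hr]
    by_cases hU : (⟨γ, hγ⟩ : UnitSpace G) ∈ (U : Set (UnitSpace G))
    · obtain ⟨v, hv, hvγ⟩ := hOV (hUO hU)
      have hsf : (s * f) γ = c := by
        rw [← hs v hv]
        exact congrArg (s * f).toFun (congrArg Subtype.val hvγ).symm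
      rw [if_pos hU, if_pos hU, hsf, inv_mul_cancel₀ hc0]
      rw [charFn, indicator_of_mem (mem_image_of_mem Subtype.val hU)]
    · rw [if_neg hU, mul_zero]
      refine (indicator_of_notMem ?_ _).symm
      rintro ⟨x, hx, rfl⟩
      exact hU hx
  · have h0 : (if domU γ ∈ (U : Set (UnitSpace G)) then
        (if rngU γ ∈ (U : Set (UnitSpace G)) then (s * f) γ else 0) else 0) = 0 := by
      split_ifs with hd hr
      · exact hO0 γ (hUO hd) (hUO hr) hγ
      · rfl
      · rfl
    rw [h0, mul_zero]
    refine (indicator_of_notMem ?_ _).symm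
    rintro ⟨x, -, rfl⟩
    exact hγ x.2

end SteinbergAlgebra

/-! ### Application to ideals -/

theorem TwoSidedIdeal.exists_mem_ne_zero {R : Type*} [NonUnitalNonAssocRing R]
    {J : TwoSidedIdeal R} (hJ : J ≠ ⊥) : ∃ x ∈ J, x ≠ 0 := by
  by_contra! h
  exact hJ (le_bot_iff.1 fun x hx => by rw [h x hx]; exact zero_mem _)

theorem mainTheorem12 {G : Type*} [TopologicalSpace G] [ArrowGroupoid G] [IsAmpleGroupoid G]
    (hG : IsTopologicallyFree G) (K : Type*) [Field K] :
    (∀ J : TwoSidedIdeal (EssentialAlgebra K G), J ≠ ⊥ →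
      ∃ U : TopologicalSpace.CompactOpens (ArrowGroupoid.UnitSpace G),
        (U : Set (ArrowGroupoid.UnitSpace G)).Nonempty ∧
          (SteinbergAlgebra.unitChar K U).coset ∈ J) ∧
    (T2Space G → ∀ J : TwoSidedIdeal (SteinbergAlgebra K G), J ≠ ⊥ →
      ∃ U : TopologicalSpace.CompactOpens (ArrowGroupoid.UnitSpace G),
        (U : Set (ArrowGroupoid.UnitSpace G)).Nonempty ∧
          SteinbergAlgebra.unitChar K U ∈ J) := by
  refine ⟨fun J hJ => ?_, fun _ J hJ => ?_⟩
  · obtain ⟨⟨f⟩, hfJ, hf0⟩ := TwoSidedIdeal.exists_mem_ne_zero hJ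
    -- A singular representative would make the coset zero.
    have hf : ¬ f.IsSingular := fun hs => hf0 <| Quotient.sound <|
      ((singularIdeal K G).rel_iff f 0).2 <| by
        rw [sub_zero, singularIdeal, TwoSidedIdeal.mem_mk']
        exact hs
    obtain ⟨U, hU, a, b, hab⟩ := SteinbergAlgebra.exists_mul_mul_eq_unitChar hG hf
    refine ⟨U, hU, ?_⟩
    rw [← hab]
    -- The coset of `a * f * b` is by definition the product of the three cosets.
    exact J.mul_mem_right _ b.coset (J.mul_mem_left a.coset _ hfJ)
  · obtain ⟨f, hfJ, hf0⟩ := TwoSidedIdeal.exists_mem_ne_zero hJ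
    obtain ⟨U, hU, a, b, hab⟩ := SteinbergAlgebra.exists_mul_mul_eq_unitChar hG
      (SteinbergAlgebra.not_isSingular_of_ne_zero hf0)
    exact ⟨U, hU, hab ▸ J.mul_mem_right _ b (J.mul_mem_left a _ hfJ)⟩
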